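/- A rooted labeled forest on $[n]=\{1,\dots,n\}$ is a forest with vertex set $[n]$ (vertices are identified with their labels) in which every connected component has a distinguished root and is viewed as an unordered rooted tree. A consecutive instance of a permutation $\pi=\pi(1)\cdots\pi(k)$ of $[k]$ in such a forest is a sequence of vertices $v_1,\dots,v_k$ such that $v_i$ is the parent of $v_{i+1}$ for $1\le i<k$ and the labels of $v_1,\dots,v_k$ are in the same relative order as $\pi(1),\dots,\pi(k)$. Two permutations $\pi,\pi'$ of $[k]$ are strongly c-forest-Wilf equivalent if for all $m,n\ge 0$ the number of rooted labeled forests on $[n]$ with exactly $m$ consecutive instances of $\pi$ equals the number of those with exactly $m$ consecutive instances of $\pi'$. The streak of $\pi$ is the largest integer $m\le k$ with $\pi(i)=i$ for all $1\le i\le m$. For $1<i\le k$, the height of the value $\pi(i)$ in $\pi$ is the largest integer $m<i$ with $\pi(i-m+1)<\dots<\pi(i)$, i.e. the length of the longest increasing run of consecutive entries that ends at position $i$ and begins after position $1$. The permutation $\pi$ is grounded if it is not the identity and there is an integer $1\le m\le k$ such that $\pi(i)=i$ for all $1\le i\le m$ and no $m+1$ consecutive entries of $\pi(2)\cdots\pi(k)$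 are increasing. **Proposition.** Let $\pi$ and $\pi'$ be grounded permutations of $[k]$ that are strongly c-forest-Wilf equivalent. Then $\pi$ and $\pi'$ have the same streak. Moreover, for every $i\in\{2,\dots,k\}$ the height of the value $i$ in $\pi$ equals the height of the value $i$ in $\pi'$. -/

import Mathlib

/-- A rooted labeled forest whose vertices are identified with their labels, the elements of `V`.
It is recorded by its parent map (`none` at the roots of the components). Well-foundedness of the
parent relation says that following parents from any vertex ends, after finitely many steps, at a
root, so that every component is an (unordered) tree with exactly one distinguished root. -/
@[ext]
structure RootedForest (V : Type*) where
  parent : V → Option V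
  wf : WellFounded (fun u v : V => parent v = some u)

namespace RootedForest

instance {V : Type*} [Finite V] : Finite (RootedForest V) :=
  Finite.of_injective RootedForest.parent fun _ _ h => RootedForest.ext h

/-- `v 0, …, v (k-1)` is a consecutive instance of the pattern `π` in the forest `F`: each vertex is
the parent of the next one, and the labels are in the same relative order as `π`. -/
def IsConsecutiveInstance {V : Type*} [LinearOrder V] {k : ℕ} (F : RootedForest V)
    (π : Equiv.Perm (Fin k)) (v : Fin k → V) : Prop :=
  (∀ i j : Fin k, i.val + 1 = j.val → F.parent (v j) = some (v i)) ∧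
    ∀ i j : Fin k, v i < v j ↔ π i < π j

/-- The number of consecutive instances of `π` in the forest `F`. -/
noncomputable def instanceCount {V : Type*} [LinearOrder V] {k : ℕ} (F : RootedForest V)
    (π : Equiv.Perm (Fin k)) : ℕ :=
  Nat.card {v : Fin k → V // F.IsConsecutiveInstance π v}

end RootedForest

/-- The number of rooted labeled forests on an `n`-element linearly ordered label set with exactly
`m` consecutive instances of `π`. -/
noncomputable def forestCount {k : ℕ} (π : Equiv.Perm (Fin k)) (n m : ℕ) : ℕ :=
  Nat.card {F : RootedForest (Fin n) // F.instanceCount π = m}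

/-- Strong c-forest-Wilf equivalence of two patterns. -/
def StronglyCForestWilfEquivalent {k l : ℕ} (π : Equiv.Perm (Fin k)) (π' : Equiv.Perm (Fin l)) :
    Prop :=
  ∀ m n : ℕ, forestCount π n m = forestCount π' n m

namespace Pattern

/-! A pattern of length `k` is a permutation of `Fin k = {0, …, k-1}`: both positions and values
are shifted down by one with respect to `{1, …, k}`. -/

/-- The first `m` entries of `π` are `1, …, m`. -/
def FixesFirst {k : ℕ} (π : Equiv.Perm (Fin k)) (m : ℕ) : Prop :=
  ∀ i : Fin k, i.val < m → π i = i

instance {k : ℕ} (π : Equiv.Perm (Fin k)) : DecidablePred (FixesFirst π) := fun m =>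
  inferInstanceAs (Decidable (∀ i : Fin k, i.val < m → π i = i))

/-- The streak of `π`: the largest `m ≤ k` such that the first `m` entries of `π` are `1, …, m`. -/
def streak {k : ℕ} (π : Equiv.Perm (Fin k)) : ℕ :=
  Nat.findGreatest (FixesFirst π) k

/-- The (at most `m`) entries of `π` at the positions `i - m + 1, …, i` are increasing. -/
def IncreasingEndingAt {k : ℕ} (π : Equiv.Perm (Fin k)) (i : Fin k) (m : ℕ) : Prop :=
  ∀ a b : Fin k, i.val < a.val + m → a < b → b ≤ i → π a < π b

instance {k : ℕ} (π : Equiv.Perm (Fin k)) (i : Fin k) : DecidablePred (IncreasingEndingAt π i) :=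
  fun m => inferInstanceAs
    (Decidable (∀ a b : Fin k, i.val < a.val + m → a < b → b ≤ i → π a < π b))

/-- The height of the entry at position `i` (not the first position): the length of the longest
consecutive increasing subsequence that ends at position `i` and begins after the first position.
In the zero-based position `i`, the bound `m ≤ i` excludes exactly the first position. -/
def heightAt {k : ℕ} (π : Equiv.Perm (Fin k)) (i : Fin k) : ℕ :=
  Nat.findGreatest (IncreasingEndingAt π i) i.val

/-- The height in `π` of the value `j`, which is not the first entry of `π`. -/
def height {k : ℕ} (π : Equiv.Perm (Fin k)) (j : Fin k) : ℕ :=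
  heightAt π (π.symm j)

/-- `π` is grounded: it is not the identity, and for some `1 ≤ m ≤ k` its first `m` entries are
`1, …, m`, while no `m + 1` consecutive entries after the first entry are increasing
(they would occupy the zero-based positions `a, …, a + m` with `1 ≤ a`). -/
def IsGrounded {k : ℕ} (π : Equiv.Perm (Fin k)) : Prop :=
  π ≠ 1 ∧ ∃ m : ℕ, 1 ≤ m ∧ m ≤ k ∧ FixesFirst π m ∧
    ¬ ∃ a : ℕ, 1 ≤ a ∧ a + m < k ∧
      ∀ i j : Fin k, a ≤ i.val → i < j → j.val ≤ a + m → π i < π j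

end Pattern

/-! The invariant is the second moment of the number of instances. Summed over all forests on `n`
labels, the square of `instanceCount` counts a forest together with an ordered pair of instances in
it. When `n < 2 * k` the two sequences must meet, and two downward paths that meet share one segment
which is initial in one of them, so their union is a rooted tree. The number of forests containing a
prescribed rooted tree depends only on its number of vertices (`card_extensions`). Hence, by
induction on `n`, equivalent patterns have equally many linked pairs using all of `n` labels
(`card_linkedPairs_eq`). For `n = 2 * k - j` such pairs overlap in exactly `j` entries, at some
shift `i`. If `π` fixes its first `j` entries, a shift `i` is possible only when the `j` entries of
`π` from position `i` on increase. The tail of the second sequence is then an arbitrary set of `k -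
j` labels above the last shared label, whose value is an entry `t` of `π`; this gives `(2 * k - j -
1 - t).choose (k - j)` pairs (`card_linkedPairsAt`). The positive shifts that contribute correspond
to the values `t` of height at least `j`. These binomials form a superincreasing sequence, so their
sum determines the set of such `t`; letting `j` run up to the streak recovers all heights. The
streaks agree because overlapping in the larger of two different streaks would allow positive shifts
for one grounded pattern but none for the other. -/

/-- The vertices `v 0, v 1, …` form a downward path in the forest `F`. -/
def RootedForest.IsPath {V : Type*} {k : ℕ} (F : RootedForest V) (v : Fin k → V) : Prop :=
  ∀ i j : Fin k, i.val + 1 = j.val → F.parent (v j) = some (v i)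

/-- The labels `v 0, v 1, …` are in the same relative order as `π`. -/
def HasPattern {V : Type*} [LinearOrder V] {k : ℕ} (π : Equiv.Perm (Fin k)) (v : Fin k → V) :
    Prop :=
  ∀ i j : Fin k, v i < v j ↔ π i < π j

/-- The sequences `v` and `w` coincide exactly along `j` consecutive entries, which are the first
ones of `w` and start at position `i` of `v`. -/
def LinkedAt {V : Type*} {k : ℕ} (v w : Fin k → V) (i j : ℕ) : Prop :=
  ∀ a b : Fin k, v a = w b ↔ a.val = i + b.val ∧ b.val < j

/-- One of the sequences `v` and `w` starts inside the other one, and they coincide along a common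
segment and nowhere else. -/
def Linked {V : Type*} {k : ℕ} (v w : Fin k → V) : Prop :=
  ∃ i j : ℕ, 1 ≤ j ∧ i + j ≤ k ∧ (LinkedAt v w i j ∨ LinkedAt w v i j)

/-! ### Overlaps of two downward paths. -/

namespace RootedForest

theorem exists_depth {V : Type*} (F : RootedForest V) :
    ∃ d : V → ℕ, ∀ x y, F.parent x = some y → d x = d y + 1 := by
  classical
  let d : V → ℕ := F.wf.fix fun x ih =>
    if h : ∃ y, F.parent x = some y then ih h.choose h.choose_spec + 1 else 0
  refine ⟨d, fun x y hxy => ?_⟩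
  have hex : ∃ y, F.parent x = some y := ⟨y, hxy⟩
  have hc : hex.choose = y := Option.some_injective _ (hex.choose_spec.symm.trans hxy)
  have : d x = if h : ∃ y, F.parent x = some y then d h.choose + 1 else 0 := F.wf.fix_eq _ x
  rw [this, dif_pos hex, hc]

theorem IsPath.depth_eq {V : Type*} {k : ℕ} {F : RootedForest V} {v : Fin k → V} (hv : F.IsPath v)
    {d : V → ℕ} (hd : ∀ x y, F.parent x = some y → d x = d y + 1) :
    ∀ (n : ℕ) (h : n < k), d (v ⟨n, h⟩) = d (v ⟨0, by omega⟩) + n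
  | 0, _ => rfl
  | n + 1, h => by
    rw [hd _ _ (hv ⟨n, by omega⟩ ⟨n + 1, h⟩ rfl), hv.depth_eq hd n]
    omega

theorem IsPath.eq_sub {V : Type*} {k : ℕ} {F : RootedForest V} {v w : Fin k → V} (hv : F.IsPath v)
    (hw : F.IsPath w) : ∀ (c a b : ℕ) (ha : a + c < k) (hb : b + c < k),
      v ⟨a + c, ha⟩ = w ⟨b + c, hb⟩ → v ⟨a, by omega⟩ = w ⟨b, by omega⟩
  | 0, _, _, _, _, h => h
  | c + 1, a, b, ha, hb, h => by
    refine hv.eq_sub hw c a b (by omega) (by omega) (Option.some_injective _ ?_)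
    rw [← hv ⟨a + c, by omega⟩ ⟨a + (c + 1), ha⟩ rfl, ← hw ⟨b + c, by omega⟩ ⟨b + (c + 1), hb⟩ rfl,
      h]

/-- Parents are unique, so agreement propagates upward and the common entries start at the top of
`w`; depth increases by one along a path, so the offset between equal entries is constant. -/
theorem IsPath.linkedAt {V : Type*} {k : ℕ} {F : RootedForest V} {v w : Fin k → V}
    (hv : F.IsPath v) (hw : F.IsPath w) {a b : Fin k} (hab : v a = w b) (hba : b ≤ a) :
    ∃ i j : ℕ, 1 ≤ j ∧ i + j ≤ k ∧ LinkedAt v w i j := by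
  classical
  obtain ⟨d, hd⟩ := F.exists_depth
  obtain ⟨a, ha⟩ := a
  obtain ⟨b, hb⟩ := b
  obtain ⟨i, rfl⟩ : ∃ i, a = i + b := ⟨a - b, by have : b ≤ a := hba; omega⟩
  have h0 : v ⟨i, by omega⟩ = w ⟨0, by omega⟩ :=
    hv.eq_sub hw b i 0 ha (by omega) (by simpa using hab)
  let P : ℕ → Prop := fun b => ∃ h : i + b < k, v ⟨i + b, h⟩ = w ⟨b, by omega⟩
  have hP0 : P 0 := ⟨by omega, h0⟩
  have hmono : ∀ b c, P (b + c) → P b := fun b c ⟨h, e⟩ =>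
    ⟨by omega, hv.eq_sub hw c (i + b) b (by omega) (by omega) (by simpa [add_assoc] using e)⟩
  have hex : ∃ b, ¬ P b := ⟨k - i, fun ⟨h, _⟩ => by omega⟩
  have hj : ∀ b, P b ↔ b < Nat.find hex := fun b =>
    ⟨fun h => by
      by_contra hlt
      exact Nat.find_spec hex (hmono _ (b - Nat.find hex) (by
        rwa [Nat.add_sub_cancel' (not_lt.1 hlt)])),
     fun h => by_contra fun hn => Nat.find_min hex h hn⟩
  refine ⟨i, Nat.find hex, (hj 0).1 hP0, ?_, ?_⟩
  · have : ¬ k - i < Nat.find hex := fun h => by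
      obtain ⟨h, _⟩ := (hj _).2 h
      omega
    omega
  · rintro ⟨a', ha'⟩ ⟨b', hb'⟩
    constructor
    · intro h
      have h1 := hv.depth_eq hd a' ha'
      have h2 := hw.depth_eq hd b' hb'
      have h3 := hv.depth_eq hd i (by omega)
      rw [h0] at h3
      rw [h] at h1
      have : a' = i + b' := by omega
      subst this
      exact ⟨rfl, (hj b').1 ⟨ha', h⟩⟩
    · rintro ⟨h1, h2⟩
      obtain ⟨h3, h4⟩ := (hj b').2 h2
      simp only at h1
      subst h1
      exact h4

theorem IsPath.linked {V : Type*} {k : ℕ} {F : RootedForest V} {v w : Fin k → V}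
    (hv : F.IsPath v) (hw : F.IsPath w) {a b : Fin k} (hab : v a = w b) : Linked v w := by
  rcases le_total b a with h | h
  · obtain ⟨i, j, h1, h2, h3⟩ := hv.linkedAt hw hab h
    exact ⟨i, j, h1, h2, Or.inl h3⟩
  · obtain ⟨i, j, h1, h2, h3⟩ := hw.linkedAt hv hab.symm h
    exact ⟨i, j, h1, h2, Or.inr h3⟩

/-! ### Counting the forests that contain a prescribed tree. -/

/-- The forest obtained from `F` by relabeling along `σ` and replacing the tree on `σ⁻¹ U'` by the
one on `U'` given by the parent map `p'`. -/
def transplant {V : Type*} (F : RootedForest V) (σ : Equiv.Perm V) {U U' : Finset V}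
    {r r' : V} {p p' : V → V} {d' : V → ℕ} [DecidablePred (fun y => y ∈ U' ∧ y ≠ r')]
    (hσ : ∀ x, σ x ∈ U' ↔ x ∈ U) (hr : σ r = r')
    (hp : ∀ x ∈ U, x ≠ r → p x ∈ U) (hp' : ∀ x ∈ U', x ≠ r' → p' x ∈ U' ∧ d' (p' x) < d' x)
    (hF : ∀ x ∈ U, x ≠ r → F.parent x = some (p x)) : RootedForest V where
  parent y := if y ∈ U' ∧ y ≠ r' then some (p' y) else (F.parent (σ.symm y)).map σ
  wf := by
    set R : V → V → Prop := fun u v =>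
      (if v ∈ U' ∧ v ≠ r' then some (p' v) else (F.parent (σ.symm v)).map σ) = some u with hR
    have hRU : ∀ u v, v ∈ U' → v ≠ r' → R u v → u = p' v := fun u v h1 h2 h => by
      simpa [hR, h1, h2, eq_comm] using h
    have hRn : ∀ u v, ¬ (v ∈ U' ∧ v ≠ r') → R u v → ∃ q, F.parent (σ.symm v) = some q ∧ σ q = u :=
      fun u v h1 h => by
        simpa only [hR, if_neg h1, Option.map_eq_some_iff] using h
    -- The tree on `U'` is treated as a block: it is accessible as soon as the parent of its root
    -- is, whichever vertex of `U` the induction on `F` has reached.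
    have key : ∀ x, (x ∈ U → ∀ y ∈ U', Acc R y) ∧ (x ∉ U → Acc R (σ x)) := by
      intro x
      induction x using F.wf.induction with
      | _ x ih =>
      have hacc : ∀ q, F.parent x = some q → Acc R (σ q) := fun q hq => by
        by_cases hqU : q ∈ U
        · exact (ih q hq).1 hqU _ ((hσ q).2 hqU)
        · exact (ih q hq).2 hqU
      constructor
      · intro hx
        by_cases hxr : x = r
        · have hr' : Acc R r' := ⟨_, fun z hz => by
            obtain ⟨q, hq, rfl⟩ := hRn z r' (by simp) hz
            rw [← hr, σ.symm_apply_apply, ← hxr] at hq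
            exact hacc q hq⟩
          intro y
          induction hn : d' y using Nat.strong_induction_on generalizing y with
          | _ n IH =>
          intro hy
          by_cases hyr : y = r'
          · rwa [hyr]
          · refine ⟨_, fun z hz => ?_⟩
            rw [hRU z y hy hyr hz]
            exact IH _ (hn ▸ (hp' y hy hyr).2) _ rfl (hp' y hy hyr).1
        · exact (ih _ (hF x hx hxr)).1 (hp x hx hxr)
      · intro hx
        refine ⟨_, fun z hz => ?_⟩
        obtain ⟨q, hq, rfl⟩ := hRn z (σ x) (by rw [hσ]; tauto) hz
        rw [σ.symm_apply_apply] at hq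
        exact hacc q hq
    refine ⟨fun y => ?_⟩
    by_cases hy : y ∈ U'
    · exact (key (σ.symm y)).1 ((hσ _).1 (by simpa using hy)) y hy
    · simpa using (key (σ.symm y)).2 (fun h => hy (by simpa using (hσ _).2 h))

/-- Transplanting is injective: inside the block the parents are prescribed, and elsewhere,
including at the root, the parent in `F` is read off through `σ`. Used in both directions, it shows
that the shape of the tree does not matter. -/
theorem card_extensions_le {V : Type*} [Finite V] {U U' : Finset V} {r r' : V} {p p' : V → V}
    {d' : V → ℕ} (hcard : U.card = U'.card) (hr : r ∈ U) (hr' : r' ∈ U')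
    (hp : ∀ x ∈ U, x ≠ r → p x ∈ U)
    (hp' : ∀ x ∈ U', x ≠ r' → p' x ∈ U' ∧ d' (p' x) < d' x) :
    Nat.card {F : RootedForest V // ∀ x ∈ U, x ≠ r → F.parent x = some (p x)} ≤
      Nat.card {F : RootedForest V // ∀ x ∈ U', x ≠ r' → F.parent x = some (p' x)} := by
  classical
  obtain ⟨σ, hσ, hσr⟩ : ∃ σ : Equiv.Perm V, (∀ x, σ x ∈ U' ↔ x ∈ U) ∧ σ r = r' := by
    have e : {x // x ∈ U} ≃ {x // x ∈ U'} := Finset.equivOfCardEq hcard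
    let e' := e.trans (Equiv.swap (e ⟨r, hr⟩) ⟨r', hr'⟩)
    have := Fintype.ofFinite V
    refine ⟨e'.extendSubtype, fun x => ⟨fun h => ?_, fun h => e'.extendSubtype_mem x h⟩, ?_⟩
    · by_contra hx
      exact e'.extendSubtype_not_mem x hx h
    · rw [e'.extendSubtype_apply_of_mem r hr]
      simp [e']
  refine Nat.card_le_card_of_injective
    (fun F => ⟨F.1.transplant σ hσ hσr hp hp' F.2, fun x hx hxr => if_pos ⟨hx, hxr⟩⟩) ?_
  intro F G h
  apply Subtype.ext
  apply RootedForest.ext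
  funext x
  by_cases hx : x ∈ U ∧ x ≠ r
  · rw [F.2 x hx.1 hx.2, G.2 x hx.1 hx.2]
  · have h1 := congrFun (congrArg (fun F => F.1.parent) h) (σ x)
    change (if σ x ∈ U' ∧ σ x ≠ r' then some (p' (σ x)) else (F.1.parent (σ.symm (σ x))).map σ) =
      (if σ x ∈ U' ∧ σ x ≠ r' then some (p' (σ x)) else (G.1.parent (σ.symm (σ x))).map σ) at h1
    have h2 : ¬ (σ x ∈ U' ∧ σ x ≠ r') := by
      rwa [hσ, ← hσr, σ.injective.ne_iff]
    rw [if_neg h2, if_neg h2, σ.symm_apply_apply] at h1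
    exact Option.map_injective σ.injective h1

/-- The number of forests on `Fin n` in which `0, …, m - 1` is a downward path. -/
noncomputable def chainCount (n m : ℕ) : ℕ :=
  Nat.card {F : RootedForest (Fin n) // ∀ x : Fin n, x.val < m → 0 < x.val →
    F.parent x = some ⟨x.val - 1, by omega⟩}

theorem chainCount_pos (n m : ℕ) : 0 < chainCount n m := by
  let F : RootedForest (Fin n) :=
    { parent := fun x => if 0 < x.val then some ⟨x.val - 1, by omega⟩ else none
      wf := Subrelation.wf (r := InvImage (· < ·) Fin.val) (by
        intro u v h
        split_ifs at h with hv
        have := congrArg Fin.val (Option.some_injective _ h)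
        simp only at this
        change u.val < v.val
        omega) (InvImage.wf _ wellFounded_lt) }
  have : Nonempty {F : RootedForest (Fin n) // ∀ x : Fin n, x.val < m → 0 < x.val →
    F.parent x = some ⟨x.val - 1, by omega⟩} := ⟨F, fun x _ hx => if_pos hx⟩
  exact Nat.card_pos

theorem card_extensions {n : ℕ} {U : Finset (Fin n)} {r : Fin n} {p : Fin n → Fin n}
    {d : Fin n → ℕ} (hr : r ∈ U) (hp : ∀ x ∈ U, x ≠ r → p x ∈ U ∧ d (p x) < d x) :
    Nat.card {F : RootedForest (Fin n) // ∀ x ∈ U, x ≠ r → F.parent x = some (p x)} =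
      chainCount n U.card := by
  have hU : U.card ≤ n := by simpa using U.card_le_univ
  have hU0 : 0 < U.card := Finset.card_pos.2 ⟨r, hr⟩
  have : NeZero n := ⟨by omega⟩
  let U' : Finset (Fin n) := Finset.univ.filter fun x => x.val < U.card
  have hU' : U'.card = U.card := by
    simp only [U']
    rw [Fin.card_filter_val_lt]
    omega
  let p' : Fin n → Fin n := fun x => ⟨x.val - 1, by omega⟩
  have h0 : (0 : Fin n) ∈ U' := by simp [U', hU0]
  have hp' : ∀ x ∈ U', x ≠ 0 → p' x ∈ U' ∧ (p' x).val < x.val := fun x hx hx0 => by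
    have : x.val ≠ 0 := fun h => hx0 (Fin.ext h)
    simp only [U', p', Finset.mem_filter, Finset.mem_univ, true_and] at hx ⊢
    omega
  have e : chainCount n U.card =
      Nat.card {F : RootedForest (Fin n) // ∀ x ∈ U', x ≠ 0 → F.parent x = some (p' x)} := by
    refine Nat.card_congr (Equiv.subtypeEquivRight fun F => ?_)
    simp only [U', p', Nat.pos_iff_ne_zero, Finset.mem_filter, Finset.mem_univ, true_and, ne_eq,
      Fin.ext_iff, Fin.val_zero]
  rw [e]
  exact le_antisymm
    (card_extensions_le hU'.symm hr h0 (fun x h1 h2 => (hp x h1 h2).1) hp')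
    (card_extensions_le hU' h0 hr (fun x h1 h2 => (hp' x h1 h2).1) hp)

/-- Glued along an initial segment of `w`, the two paths form one tree rooted at `v 0`, to which
`card_extensions` applies. -/
theorem card_isPath_of_linkedAt {n k i j : ℕ} {v w : Fin k → Fin n} (hv : v.Injective)
    (hw : w.Injective) (hj : 1 ≤ j) (hij : i + j ≤ k) (h : LinkedAt v w i j) :
    Nat.card {F : RootedForest (Fin n) // F.IsPath v ∧ F.IsPath w} =
      chainCount n (Finset.univ.image v ∪ Finset.univ.image w).card := by
  classical
  have : NeZero k := ⟨by omega⟩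
  set U := Finset.univ.image v ∪ Finset.univ.image w with hU
  have memv : ∀ a, v a ∈ U := fun a => by simp [hU]
  have memw : ∀ a, w a ∈ U := fun a => by simp [hU]
  -- Depth in the glued tree: position along `v`, or position along `w` shifted by `i`; the two
  -- agree on the overlap. The value `0` outside both paths is never used.
  let d : Fin n → ℕ := fun x =>
    if hx : ∃ a, v a = x then hx.choose.val
    else if hx : ∃ b, w b = x then i + hx.choose.val else 0
  have dv : ∀ a, d (v a) = a.val := fun a => by
    have hx : ∃ a', v a' = v a := ⟨a, rfl⟩
    simp only [d, dif_pos hx, hv hx.choose_spec]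
  have dw : ∀ b, d (w b) = i + b.val := fun b => by
    by_cases hx : ∃ a, v a = w b
    · simp only [d, dif_pos hx, ((h _ _).1 hx.choose_spec).1]
    · have hy : ∃ b', w b' = w b := ⟨b, rfl⟩
      simp only [d, dif_neg hx, dif_pos hy, hw hy.choose_spec]
  have hex : ∀ x, x ∈ U → x ≠ v 0 → ∃ y, (y ∈ U ∧ d y < d x) ∧
      (∀ a a' : Fin k, a.val + 1 = a'.val → v a' = x → v a = y) ∧
      (∀ b b' : Fin k, b.val + 1 = b'.val → w b' = x → w b = y) ∧
      ((∃ a a' : Fin k, a.val + 1 = a'.val ∧ v a' = x ∧ v a = y) ∨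
        ∃ b b' : Fin k, b.val + 1 = b'.val ∧ w b' = x ∧ w b = y) := by
    have caseV : ∀ a', v a' ≠ v 0 → ∃ y, (y ∈ U ∧ d y < d (v a')) ∧
      (∀ a a'' : Fin k, a.val + 1 = a''.val → v a'' = v a' → v a = y) ∧
      (∀ b b' : Fin k, b.val + 1 = b'.val → w b' = v a' → w b = y) ∧
      ((∃ a a'' : Fin k, a.val + 1 = a''.val ∧ v a'' = v a' ∧ v a = y) ∨
        ∃ b b' : Fin k, b.val + 1 = b'.val ∧ w b' = v a' ∧ w b = y) := by
      intro a' ha'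
      have h0 : a'.val ≠ 0 := fun hh => ha' (congrArg v (Fin.ext hh))
      refine ⟨v ⟨a'.val - 1, by omega⟩, ⟨memv _, ?_⟩, ?_, ?_, 
        Or.inl ⟨⟨a'.val - 1, by omega⟩, a', ?_, rfl, rfl⟩⟩
      · rw [dv, dv]
        simp only
        omega
      · intro a a'' h1 h2
        have := hv h2
        subst this
        congr 1
        ext
        simp only
        omega
      · intro b b' h1 h2
        have h3 := (h _ _).1 h2.symm
        symm
        rw [h]
        simp only
        omega
      · simp only
        omega
    intro x hx hxr
    by_cases hxv : ∃ a, v a = x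
    · obtain ⟨a, rfl⟩ := hxv
      exact caseV a hxr
    · obtain ⟨b', rfl⟩ : ∃ b, w b = x := by
        simp only [hU, Finset.mem_union, Finset.mem_image, Finset.mem_univ, true_and] at hx
        exact hx.resolve_left hxv
      have h0 : b'.val ≠ 0 := fun hh => hxv ⟨⟨i, by omega⟩, (h _ _).2 ⟨by simp [hh], by omega⟩⟩
      refine ⟨w ⟨b'.val - 1, by omega⟩, ⟨memw _, ?_⟩, fun a a' _ h2 => absurd ⟨a', h2⟩ hxv, ?_,
        Or.inr ⟨⟨b'.val - 1, by omega⟩, b', ?_, rfl, rfl⟩⟩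
      · rw [dw, dw]
        simp only
        omega
      · intro b b'' h1 h2
        have := hw h2
        subst this
        congr 1
        ext
        simp only
        omega
      · simp only
        omega
  choose! p hp1 hp2 hp3 hp4 using hex
  rw [← card_extensions (memv 0) hp1]
  refine Nat.card_congr (Equiv.subtypeEquivRight fun F => ⟨?_, ?_⟩)
  · rintro ⟨h1, h2⟩ x hx hxr
    rcases hp4 x hx hxr with ⟨a, a', e1, e2, e3⟩ | ⟨a, a', e1, e2, e3⟩
    · rw [← e3, ← e2, h1 a a' e1]
    · rw [← e3, ← e2, h2 a a' e1]
  · intro hF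
    have hrv : ∀ a a' : Fin k, a.val + 1 = a'.val → v a' ≠ v 0 := fun a a' e h' => by
      rw [hv h'] at e
      simp at e
    have hrw : ∀ a a' : Fin k, a.val + 1 = a'.val → w a' ≠ v 0 := fun a a' e h' => by
      have := ((h _ _).1 h'.symm).1
      simp only [Fin.val_zero] at this
      omega
    constructor
    · intro a a' e
      rw [hF _ (memv _) (hrv a a' e), ← hp2 _ (memv _) (hrv a a' e) a a' e rfl]
    · intro a a' e
      rw [hF _ (memw _) (hrw a a' e), ← hp3 _ (memw _) (hrw a a' e) a a' e rfl]

theorem card_isPath_of_linked {n k : ℕ} {v w : Fin k → Fin n} (hv : v.Injective)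
    (hw : w.Injective) (h : Linked v w) :
    Nat.card {F : RootedForest (Fin n) // F.IsPath v ∧ F.IsPath w} =
      chainCount n (Finset.univ.image v ∪ Finset.univ.image w).card := by
  obtain ⟨i, j, hj, hij, h | h⟩ := h
  · exact card_isPath_of_linkedAt hv hw hj hij h
  · rw [Finset.union_comm, ← card_isPath_of_linkedAt hw hv hj hij h]
    exact Nat.card_congr (Equiv.subtypeEquivRight fun F => and_comm)

end RootedForest

/-! ### Linked pairs and their label sets. -/

theorem HasPattern.injective {V : Type*} [LinearOrder V] {k : ℕ} {π : Equiv.Perm (Fin k)}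
    {v : Fin k → V} (h : HasPattern π v) : v.Injective := by
  intro a b hab
  have h1 := (h a b).not.1 (by simp [hab])
  have h2 := (h b a).not.1 (by simp [hab])
  exact π.injective (le_antisymm (not_lt.1 h2) (not_lt.1 h1))

theorem hasPattern_comp {V W : Type*} [LinearOrder V] [LinearOrder W] {k : ℕ}
    {π : Equiv.Perm (Fin k)} (e : V ↪o W) (v : Fin k → V) :
    HasPattern π (e ∘ v) ↔ HasPattern π v := by
  simp [HasPattern]

theorem linked_comp {V W : Type*} {k : ℕ} {e : V → W} (he : e.Injective) (v w : Fin k → V) :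
    Linked (e ∘ v) (e ∘ w) ↔ Linked v w := by
  simp [Linked, LinkedAt, he.eq_iff]

/-- The set of all labels occurring in one of two sequences. -/
def pairSupport {V : Type*} [DecidableEq V] {k : ℕ} (p : (Fin k → V) × (Fin k → V)) : Finset V :=
  Finset.univ.image p.1 ∪ Finset.univ.image p.2

open Classical in
/-- The linked pairs of sequences in `Fin n` with pattern `π` and with `m` labels in total. -/
noncomputable def linkedPairs {k : ℕ} (π : Equiv.Perm (Fin k)) (n m : ℕ) :
    Finset ((Fin k → Fin n) × (Fin k → Fin n)) :=
  Finset.univ.filter fun p =>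
    (HasPattern π p.1 ∧ HasPattern π p.2 ∧ Linked p.1 p.2) ∧ (pairSupport p).card = m

theorem mem_linkedPairs {k n m : ℕ} {π : Equiv.Perm (Fin k)}
    {p : (Fin k → Fin n) × (Fin k → Fin n)} : p ∈ linkedPairs π n m ↔
      (HasPattern π p.1 ∧ HasPattern π p.2 ∧ Linked p.1 p.2) ∧ (pairSupport p).card = m := by
  simp [linkedPairs]

theorem card_linkedPairs_filter {k n m : ℕ} (π : Equiv.Perm (Fin k)) (U : Finset (Fin n))
    (hU : U.card = m) :
    ((linkedPairs π n m).filter fun p => pairSupport p = U).card = (linkedPairs π m m).card := by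
  symm
  set e := U.orderEmbOfFin hU with he
  have hsupp : ∀ p : (Fin k → Fin m) × (Fin k → Fin m),
      pairSupport (e ∘ p.1, e ∘ p.2) = (pairSupport p).image e := fun p => by
    simp [pairSupport, Finset.image_union, Finset.image_image]
  have himg : Finset.univ.image e = U := by
    ext x
    have : x ∈ Set.range e ↔ x ∈ U := by rw [he, Finset.range_orderEmbOfFin, Finset.mem_coe]
    rw [← this]
    simp
  refine Finset.card_bij (fun p _ => (e ∘ p.1, e ∘ p.2)) ?_ ?_ ?_
  · intro p hp
    obtain ⟨⟨h1, h2, h3⟩, h4⟩ := mem_linkedPairs.1 hp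
    have h5 : pairSupport p = Finset.univ := by
      rw [← Finset.card_eq_iff_eq_univ, h4, Fintype.card_fin]
    have h6 : pairSupport (e ∘ p.1, e ∘ p.2) = U := by rw [hsupp, h5, himg]
    rw [Finset.mem_filter, mem_linkedPairs]
    exact ⟨⟨⟨(hasPattern_comp e _).2 h1, (hasPattern_comp e _).2 h2,
      (linked_comp e.injective _ _).2 h3⟩, by rw [h6, hU]⟩, h6⟩
  · rintro ⟨v, w⟩ _ ⟨v', w'⟩ _ h
    simp only [Prod.mk.injEq] at h
    exact Prod.ext (e.injective.comp_left h.1) (e.injective.comp_left h.2)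
  · rintro ⟨v, w⟩ hp
    rw [Finset.mem_filter, mem_linkedPairs] at hp
    obtain ⟨⟨⟨h1, h2, h3⟩, h4⟩, h5⟩ := hp
    have hv : ∀ a, ∃ x, e x = v a := fun a => by
      have : v a ∈ Finset.univ.image e := by
        rw [himg, ← h5]
        simp [pairSupport]
      simpa using this
    have hw : ∀ a, ∃ x, e x = w a := fun a => by
      have : w a ∈ Finset.univ.image e := by
        rw [himg, ← h5]
        simp [pairSupport]
      simpa using this
    choose v₀ hv₀ using hv
    choose w₀ hw₀ using hw
    obtain rfl : e ∘ v₀ = v := funext hv₀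
    obtain rfl : e ∘ w₀ = w := funext hw₀
    refine ⟨(v₀, w₀), mem_linkedPairs.2 ⟨⟨(hasPattern_comp e _).1 h1, (hasPattern_comp e _).1 h2,
      (linked_comp e.injective _ _).1 h3⟩, ?_⟩, rfl⟩
    rw [hsupp (v₀, w₀), Finset.card_image_of_injective _ e.injective] at h4
    exact h4

/-- Pattern and linkage are invariant under order-preserving relabeling, so every `m`-set of labels
supports the same number of pairs. -/
theorem card_linkedPairs {k : ℕ} (π : Equiv.Perm (Fin k)) (n m : ℕ) :
    (linkedPairs π n m).card = n.choose m * (linkedPairs π m m).card := by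
  classical
  have h := Finset.card_eq_sum_card_fiberwise (f := pairSupport) (s := linkedPairs π n m)
    (t := Finset.powersetCard m Finset.univ) (fun p hp => by
      simpa using (mem_linkedPairs.1 hp).2)
  rw [h, Finset.sum_congr rfl fun U hU =>
    card_linkedPairs_filter π U (Finset.mem_powersetCard.1 hU).2]
  simp

/-! ### The second moment of the number of instances. -/

namespace RootedForest

theorem card_isConsecutiveInstance_pair {n k : ℕ} (π : Equiv.Perm (Fin k)) (hn : n < 2 * k)
    (p : (Fin k → Fin n) × (Fin k → Fin n))
    [Decidable (HasPattern π p.1 ∧ HasPattern π p.2 ∧ Linked p.1 p.2)] :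
    Nat.card {F : RootedForest (Fin n) //
        F.IsConsecutiveInstance π p.1 ∧ F.IsConsecutiveInstance π p.2} =
      if HasPattern π p.1 ∧ HasPattern π p.2 ∧ Linked p.1 p.2 then
        chainCount n (pairSupport p).card else 0 := by
  split_ifs with h
  · rw [pairSupport, ← card_isPath_of_linked h.1.injective h.2.1.injective h.2.2]
    exact Nat.card_congr (Equiv.subtypeEquivRight fun F =>
      ⟨fun H => ⟨H.1.1, H.2.1⟩, fun H => ⟨⟨H.1, h.1⟩, ⟨H.2, h.2.1⟩⟩⟩)
  · rw [Nat.card_eq_zero]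
    left
    refine ⟨fun ⟨F, ⟨h1, h2⟩, ⟨h3, h4⟩⟩ => h ⟨h2, h4, ?_⟩⟩
    have h2 : HasPattern π p.1 := h2
    have h4 : HasPattern π p.2 := h4
    -- Two disjoint sequences would need `2 * k > n` labels.
    have hdis : ¬ Disjoint (Finset.univ.image p.1) (Finset.univ.image p.2) := fun hd => by
      have := Finset.card_le_univ (Finset.univ.image p.1 ∪ Finset.univ.image p.2)
      rw [Finset.card_union_of_disjoint hd, Finset.card_image_of_injective _ h2.injective,
        Finset.card_image_of_injective _ h4.injective] at this
      simp at this
      omega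
    rw [Finset.not_disjoint_iff] at hdis
    obtain ⟨x, hx1, hx2⟩ := hdis
    simp only [Finset.mem_image, Finset.mem_univ, true_and] at hx1 hx2
    obtain ⟨a, ha⟩ := hx1
    obtain ⟨b, hb⟩ := hx2
    exact IsPath.linked (F := F) h1 h3 (ha.trans hb.symm)

theorem sum_instanceCount_sq {n k : ℕ} (π : Equiv.Perm (Fin k)) (hn : n < 2 * k)
    [Fintype (RootedForest (Fin n))] :
    ∑ F : RootedForest (Fin n), F.instanceCount π ^ 2 =
      ∑ m ∈ Finset.range (n + 1), chainCount n m * (n.choose m * (linkedPairs π m m).card) := by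
  classical
  have h1 : ∀ F : RootedForest (Fin n), F.instanceCount π ^ 2 =
      ∑ p : (Fin k → Fin n) × (Fin k → Fin n),
        if F.IsConsecutiveInstance π p.1 ∧ F.IsConsecutiveInstance π p.2 then 1 else 0 := fun F => by
    rw [instanceCount, Nat.card_eq_fintype_card, Fintype.card_subtype, sq, ← Finset.card_product,
      ← Finset.filter_product, Finset.univ_product_univ, Finset.card_filter]
  have h2 : ∀ p : (Fin k → Fin n) × (Fin k → Fin n), (∑ F : RootedForest (Fin n),
        if F.IsConsecutiveInstance π p.1 ∧ F.IsConsecutiveInstance π p.2 then 1 else 0) =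
      if HasPattern π p.1 ∧ HasPattern π p.2 ∧ Linked p.1 p.2 then
        chainCount n (pairSupport p).card else 0 := fun p => by
    rw [← card_isConsecutiveInstance_pair π hn, Nat.card_eq_fintype_card, Fintype.card_subtype,
      Finset.card_filter]
  rw [Finset.sum_congr rfl fun F _ => h1 F, Finset.sum_comm, Finset.sum_congr rfl fun p _ => h2 p,
    ← Finset.sum_filter, ← Finset.sum_fiberwise_of_maps_to (t := Finset.range (n + 1))
      (g := fun p => (pairSupport p).card)]
  · refine Finset.sum_congr rfl fun m _ => ?_
    rw [Finset.filter_filter, Finset.sum_congr rfl (g := fun _ => chainCount n m),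
      Finset.sum_const, smul_eq_mul, mul_comm, ← card_linkedPairs]
    · congr 2
    · intro p hp
      rw [(Finset.mem_filter.1 hp).2.2]
  · intro p _
    have := (pairSupport p).card_le_univ
    rw [Fintype.card_fin] at this
    exact Finset.mem_range.2 (Nat.lt_succ_of_le this)

theorem sum_comp_instanceCount {k n : ℕ} (π : Equiv.Perm (Fin k)) [Fintype (RootedForest (Fin n))]
    (f : ℕ → ℕ) {N : ℕ} (hN : ∀ F : RootedForest (Fin n), F.instanceCount π < N) :
    ∑ F : RootedForest (Fin n), f (F.instanceCount π) =
      ∑ m ∈ Finset.range N, forestCount π n m * f m := by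
  classical
  rw [← Finset.sum_fiberwise_of_maps_to (t := Finset.range N) (g := fun F => F.instanceCount π)
    (fun F _ => Finset.mem_range.2 (hN F))]
  refine Finset.sum_congr rfl fun m _ => ?_
  rw [Finset.sum_congr rfl (g := fun _ => f m), Finset.sum_const, smul_eq_mul, forestCount,
    Nat.card_eq_fintype_card, Fintype.card_subtype]
  intro F hF
  rw [(Finset.mem_filter.1 hF).2]

end RootedForest

/-- The distribution of `instanceCount` determines its second moment. By induction all terms with `m
< n` agree, and the term `m = n` has the positive coefficient `chainCount n n`, which cancels. -/
theorem StronglyCForestWilfEquivalent.card_linkedPairs_eq {k : ℕ} {π π' : Equiv.Perm (Fin k)}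
    (h : StronglyCForestWilfEquivalent π π') (n : ℕ) (hn : n < 2 * k) :
    (linkedPairs π n n).card = (linkedPairs π' n n).card := by
  induction n using Nat.strong_induction_on with
  | _ n ih =>
  have := Fintype.ofFinite (RootedForest (Fin n))
  obtain ⟨N, hN⟩ : ∃ N, ∀ F : RootedForest (Fin n), F.instanceCount π < N ∧
      F.instanceCount π' < N := by
    refine ⟨∑ F : RootedForest (Fin n), (F.instanceCount π + F.instanceCount π') + 1, fun F => ?_⟩
    have := Finset.single_le_sum (f := fun F : RootedForest (Fin n) =>
      F.instanceCount π + F.instanceCount π') (fun _ _ => Nat.zero_le _) (Finset.mem_univ F)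
    omega
  have key : ∑ F : RootedForest (Fin n), F.instanceCount π ^ 2 =
      ∑ F : RootedForest (Fin n), F.instanceCount π' ^ 2 := by
    rw [RootedForest.sum_comp_instanceCount π (· ^ 2) fun F => (hN F).1,
      RootedForest.sum_comp_instanceCount π' (· ^ 2) fun F => (hN F).2]
    exact Finset.sum_congr rfl fun m _ => by rw [h]
  rw [RootedForest.sum_instanceCount_sq π hn, RootedForest.sum_instanceCount_sq π' hn,
    Finset.sum_range_succ, Finset.sum_range_succ, Finset.sum_congr rfl fun m hm => by
      rw [ih m (Finset.mem_range.1 hm) ((Finset.mem_range.1 hm).trans hn)]] at key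
  have := Nat.add_left_cancel key
  rw [Nat.choose_self, one_mul, one_mul] at this
  exact Nat.eq_of_mul_eq_mul_left (RootedForest.chainCount_pos n n) this

/-! ### Linked pairs sorted by overlap and shift. -/

open Classical in
/-- The pairs of sequences in `Fin n` with pattern `π` which coincide exactly along the first `j`
entries of the second one, starting at position `i` of the first one. -/
noncomputable def linkedPairsAt {k : ℕ} (π : Equiv.Perm (Fin k)) (n i j : ℕ) :
    Finset ((Fin k → Fin n) × (Fin k → Fin n)) :=
  Finset.univ.filter fun p => HasPattern π p.1 ∧ HasPattern π p.2 ∧ LinkedAt p.1 p.2 i j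

theorem mem_linkedPairsAt {k n i j : ℕ} {π : Equiv.Perm (Fin k)}
    {p : (Fin k → Fin n) × (Fin k → Fin n)} : p ∈ linkedPairsAt π n i j ↔
      HasPattern π p.1 ∧ HasPattern π p.2 ∧ LinkedAt p.1 p.2 i j := by
  simp [linkedPairsAt]

theorem LinkedAt.inter_eq {V : Type*} [DecidableEq V] {k i j : ℕ} {v w : Fin k → V}
    (h : LinkedAt v w i j) (hij : i + j ≤ k) : Finset.univ.image v ∩ Finset.univ.image w =
      (Finset.univ.filter fun b : Fin k => b.val < j).image w := by
  ext x
  simp only [Finset.mem_inter, Finset.mem_image, Finset.mem_univ, true_and, Finset.mem_filter]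
  constructor
  · rintro ⟨⟨a, ha⟩, b, hb⟩
    exact ⟨b, ((h a b).1 (ha.trans hb.symm)).2, hb⟩
  · rintro ⟨b, hbj, hb⟩
    exact ⟨⟨⟨i + b, by omega⟩, ((h _ _).2 ⟨rfl, hbj⟩).trans hb⟩, b, hb⟩

theorem LinkedAt.card_union {V : Type*} [DecidableEq V] {k i j : ℕ} {v w : Fin k → V}
    (h : LinkedAt v w i j) (hv : v.Injective) (hw : w.Injective) (hij : i + j ≤ k) :
    (Finset.univ.image v ∪ Finset.univ.image w).card = 2 * k - j := by
  have := Finset.card_union_add_card_inter (Finset.univ.image v) (Finset.univ.image w)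
  rw [h.inter_eq hij, Finset.card_image_of_injective _ hv, Finset.card_image_of_injective _ hw,
    Finset.card_image_of_injective _ hw, Fin.card_filter_val_lt, Finset.card_univ,
    Fintype.card_fin, min_eq_right (by omega)] at this
  omega

theorem LinkedAt.start_unique {V : Type*} {k i i' j : ℕ} {v w : Fin k → V}
    (h : LinkedAt v w i j) (h' : LinkedAt v w i' j) (hj : 1 ≤ j) (hij : i + j ≤ k) : i = i' := by
  have := (h' _ _).1 ((h ⟨i, by omega⟩ ⟨0, by omega⟩).2 ⟨rfl, hj⟩)
  simpa using this.1

theorem LinkedAt.not_swap {V : Type*} {k i i' j : ℕ} {v w : Fin k → V}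
    (h : LinkedAt v w i j) (h' : LinkedAt w v (i' + 1) j) (hj : 1 ≤ j) (hij : i + j ≤ k) :
    False := by
  have := (h' _ _).1 ((h ⟨i, by omega⟩ ⟨0, by omega⟩).2 ⟨rfl, hj⟩).symm
  simp at this
  omega

/-- Using exactly `2 * k - j` labels means overlapping in `j` entries. Either sequence may come
first, whence the factor 2; at shift 0 the two cases coincide. -/
theorem card_linkedPairs_eq_sum {k j : ℕ} (π : Equiv.Perm (Fin k)) (hj : 1 ≤ j) (hjk : j ≤ k) :
    (linkedPairs π (2 * k - j) (2 * k - j)).card =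
      (linkedPairsAt π (2 * k - j) 0 j).card +
        2 * ∑ i ∈ Finset.range (k - j), (linkedPairsAt π (2 * k - j) (i + 1) j).card := by
  classical
  set n := 2 * k - j with hn
  have hcover : linkedPairs π n n =
      (Finset.range (k - j + 1)).biUnion (fun i => linkedPairsAt π n i j) ∪
        (Finset.range (k - j)).biUnion (fun i => (linkedPairsAt π n (i + 1) j).image Prod.swap) := by
    ext ⟨v, w⟩
    rw [mem_linkedPairs]
    simp only [Finset.mem_union, Finset.mem_biUnion, Finset.mem_range, Finset.mem_image,
      mem_linkedPairsAt, Prod.exists, Prod.swap_prod_mk, Prod.mk.injEq,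
      pairSupport]
    constructor
    · rintro ⟨⟨h1, h2, i, j', h3, h4, h | h⟩, hc⟩
      · rw [h.card_union h1.injective h2.injective h4] at hc
        obtain rfl : j' = j := by omega
        exact Or.inl ⟨i, by omega, h1, h2, h⟩
      · rw [Finset.union_comm, h.card_union h2.injective h1.injective h4] at hc
        obtain rfl : j' = j := by omega
        rcases i with _ | i
        · refine Or.inl ⟨0, by omega, h1, h2, fun a b => ?_⟩
          have := h b a
          rw [eq_comm, this]
          omega
        · exact Or.inr ⟨i, by omega, w, v, ⟨h2, h1, h⟩, rfl, rfl⟩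
    · rintro (⟨i, hi, h1, h2, h⟩ | ⟨i, hi, w', v', ⟨h2, h1, h⟩, rfl, rfl⟩)
      · exact ⟨⟨h1, h2, i, j, hj, by omega, Or.inl h⟩,
          h.card_union h1.injective h2.injective (by omega)⟩
      · refine ⟨⟨h1, h2, i + 1, j, hj, by omega, Or.inr h⟩, ?_⟩
        rw [Finset.union_comm]
        exact h.card_union h2.injective h1.injective (by omega)
  rw [hcover, Finset.card_union_of_disjoint, Finset.card_biUnion, Finset.card_biUnion,
    Finset.sum_range_succ']
  · simp only [Finset.card_image_of_injective _ Prod.swap_injective]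
    ring
  · intro i hi i' hi' hne
    rw [Finset.mem_coe, Finset.mem_range] at hi
    rw [Function.onFun, Finset.disjoint_left]
    simp only [Finset.mem_image, mem_linkedPairsAt]
    rintro _ ⟨p, hp, rfl⟩ ⟨q, hq, hqp⟩
    obtain rfl := Prod.swap_injective hqp
    exact hne (Nat.succ_injective (hp.2.2.start_unique hq.2.2 hj (by omega)))
  · intro i hi i' hi' hne
    rw [Finset.mem_coe, Finset.mem_range] at hi
    rw [Function.onFun, Finset.disjoint_left]
    intro p hp hq
    rw [mem_linkedPairsAt] at hp hq
    exact hne (hp.2.2.start_unique hq.2.2 hj (by omega))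
  · rw [Finset.disjoint_left]
    simp only [Finset.mem_biUnion, Finset.mem_range, Finset.mem_image, mem_linkedPairsAt]
    rintro p ⟨i, hi, hp⟩ ⟨i', hi', q, hq, rfl⟩
    exact hp.2.2.not_swap hq.2.2 hj (by omega)

/-! ### Counting pairs with a given overlap and shift. -/

theorem HasPattern.card_filter_lt {V : Type*} [LinearOrder V] {k : ℕ} {π : Equiv.Perm (Fin k)}
    {v : Fin k → V} (h : HasPattern π v) (a : Fin k) :
    ((Finset.univ.image v).filter (· < v a)).card = (π a).val := by
  rw [Finset.filter_image, Finset.card_image_of_injective _ h.injective, ← Fin.card_Iio,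
    ← Finset.card_map π.toEmbedding]
  congr 1
  ext x
  simp only [Finset.mem_map, Finset.mem_filter, Finset.mem_univ, true_and, Finset.mem_Iio, h _ _]
  exact ⟨by rintro ⟨b, hb, rfl⟩; exact hb, fun hx => ⟨π.symm x, by simpa using hx, by simp⟩⟩

theorem HasPattern.strictMono {V : Type*} [LinearOrder V] {k : ℕ} {π : Equiv.Perm (Fin k)}
    {v : Fin k → V} (h : HasPattern π v) : StrictMono (v ∘ π.symm) := fun a b hab => by
  simpa [h _ _] using hab

theorem HasPattern.eq_of_image_eq {V : Type*} [LinearOrder V] {k : ℕ} {π : Equiv.Perm (Fin k)}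
    {v w : Fin k → V} (hv : HasPattern π v) (hw : HasPattern π w)
    (h : Finset.univ.image v = Finset.univ.image w) : v = w := by
  have hr : Set.range v = Set.range w := by
    have := congrArg (fun s : Finset V => (s : Set V)) h
    simpa using this
  have := (hv.strictMono.range_inj hw.strictMono).1 (by
    rw [Set.range_comp, Set.range_comp, π.symm.range_eq_univ, Set.image_univ, Set.image_univ, hr])
  funext a
  simpa using congrFun this (π a)

theorem LinkedAt.image_union_eq_univ {k i j : ℕ} {v w : Fin k → Fin (2 * k - j)}
    (h : LinkedAt v w i j) (hv : v.Injective) (hw : w.Injective) (hij : i + j ≤ k) :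
    Finset.univ.image v ∪ Finset.univ.image w = Finset.univ := by
  rw [← Finset.card_eq_iff_eq_univ, h.card_union hv hw hij, Fintype.card_fin]

/-- The entries of `w` at the positions `j, j + 1, …`. -/
def tailImage {V : Type*} [DecidableEq V] {k : ℕ} (w : Fin k → V) (j : ℕ) : Finset V :=
  (Finset.univ.filter fun b : Fin k => j ≤ b.val).image w

theorem mem_tailImage {V : Type*} [DecidableEq V] {k : ℕ} {w : Fin k → V} {j : ℕ} {x : V} :
    x ∈ tailImage w j ↔ ∃ b : Fin k, j ≤ b.val ∧ w b = x := by
  simp [tailImage]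

theorem card_tailImage {V : Type*} [DecidableEq V] {k : ℕ} {w : Fin k → V} (hw : w.Injective)
    {j : ℕ} (hj : j ≤ k) : (tailImage w j).card = k - j := by
  rw [tailImage, Finset.card_image_of_injective _ hw]
  have := Finset.card_filter_add_card_filter_not (s := (Finset.univ : Finset (Fin k)))
    (fun b => b.val < j)
  simp only [not_lt, Fin.card_filter_val_lt, Finset.card_univ, Fintype.card_fin] at this
  omega

theorem LinkedAt.image_eq_compl {k i j : ℕ} {v w : Fin k → Fin (2 * k - j)}
    (h : LinkedAt v w i j) (hv : v.Injective) (hw : w.Injective) (hij : i + j ≤ k) :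
    Finset.univ.image v = (tailImage w j)ᶜ := by
  ext x
  rw [Finset.mem_compl, mem_tailImage]
  constructor
  · intro hx
    obtain ⟨a, -, rfl⟩ := Finset.mem_image.1 hx
    rintro ⟨b, hb, hba⟩
    have := ((h a b).1 hba.symm).2
    omega
  · intro hx
    have hxu := h.image_union_eq_univ hv hw hij ▸ Finset.mem_univ x
    rcases Finset.mem_union.1 hxu with hx1 | hx1
    · exact hx1
    · obtain ⟨b, -, rfl⟩ := Finset.mem_image.1 hx1
      have hb : b.val < j := by
        by_contra hb
        exact hx ⟨b, not_lt.1 hb, rfl⟩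
      exact Finset.mem_image.2 ⟨⟨i + b, by omega⟩, Finset.mem_univ _, (h _ _).2 ⟨rfl, hb⟩⟩

/-- A sequence is determined by its pattern and its label set. The labels of the first sequence are
the complement of the tail of the second. -/
theorem eq_of_tailImage_eq {k i j : ℕ} {π : Equiv.Perm (Fin k)}
    {p q : (Fin k → Fin (2 * k - j)) × (Fin k → Fin (2 * k - j))}
    (hp : p ∈ linkedPairsAt π (2 * k - j) i j) (hq : q ∈ linkedPairsAt π (2 * k - j) i j)
    (hij : i + j ≤ k) (hhead : ∀ c : Fin k, c.val < j → p.2 c = q.2 c)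
    (htail : tailImage p.2 j = tailImage q.2 j) : p = q := by
  rw [mem_linkedPairsAt] at hp hq
  refine Prod.ext (hp.1.eq_of_image_eq hq.1 ?_) (hp.2.1.eq_of_image_eq hq.2.1 ?_)
  · rw [hp.2.2.image_eq_compl hp.1.injective hp.2.1.injective hij,
      hq.2.2.image_eq_compl hq.1.injective hq.2.1.injective hij, htail]
  · have key : ∀ w : Fin k → Fin (2 * k - j), Finset.univ.image w =
        (Finset.univ.filter fun b : Fin k => b.val < j).image w ∪ tailImage w j := fun w => by
      rw [tailImage, ← Finset.image_union]
      congr 1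
      ext b
      simp [lt_or_ge]
    rw [key, key, htail]
    congr 1
    exact Finset.image_congr fun b hb => hhead b (by simpa using hb)

/-- All labels are used, so a shared label equals the number of smaller ones: those in the first
sequence are counted by its pattern, the rest lie in the tail of the second. -/
theorem val_head_eq {k i j : ℕ} {π : Equiv.Perm (Fin k)}
    {p : (Fin k → Fin (2 * k - j)) × (Fin k → Fin (2 * k - j))}
    (hp : p ∈ linkedPairsAt π (2 * k - j) i j) (hij : i + j ≤ k) (c : Fin k) (hc : c.val < j) :
    (p.2 c).val = (π ⟨i + c, by omega⟩).val +
      (Finset.univ.filter fun b : Fin k => j ≤ b.val ∧ π b < π c).card := by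
  obtain ⟨hv, hw, h⟩ := mem_linkedPairsAt.1 hp
  have hvw : p.1 ⟨i + c, by omega⟩ = p.2 c := (h _ _).2 ⟨rfl, hc⟩
  have huniv : Finset.univ = Finset.univ.image p.1 ∪ tailImage p.2 j := by
    rw [h.image_eq_compl hv.injective hw.injective hij, Finset.union_comm, Finset.union_compl]
  have hdis : Disjoint (Finset.univ.image p.1) (tailImage p.2 j) := by
    rw [h.image_eq_compl hv.injective hw.injective hij]
    exact disjoint_compl_left
  rw [← Fin.card_Iio, ← hv.card_filter_lt ⟨i + c, by omega⟩, hvw,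
    ← Finset.card_image_of_injective (Finset.univ.filter _) hw.injective,
    ← Finset.card_union_of_disjoint]
  · congr 1
    ext x
    have hx := huniv ▸ Finset.mem_univ x
    simp only [Finset.mem_Iio, Finset.mem_union, Finset.mem_filter, Finset.mem_image,
      Finset.mem_univ, true_and, mem_tailImage] at hx ⊢
    constructor
    · intro hxc
      rcases hx with hx | ⟨b, hb, rfl⟩
      · exact Or.inl ⟨hx, hxc⟩
      · exact Or.inr ⟨b, ⟨hb, (hw _ _).1 hxc⟩, rfl⟩
    · rintro (⟨_, h1⟩ | ⟨b, ⟨_, h1⟩, rfl⟩)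
      · exact h1
      · exact (hw _ _).2 h1
  · refine hdis.mono (Finset.filter_subset _ _) (Finset.image_subset_image fun b hb => ?_)
    simp only [Finset.mem_filter, Finset.mem_univ, true_and] at hb ⊢
    exact hb.1

/-- The shared labels are forced, so only the tail set, of size `k - j`, is chosen among the other
labels. -/
theorem card_linkedPairsAt_zero_le {k j : ℕ} (π : Equiv.Perm (Fin k)) (hj : j ≤ k) :
    (linkedPairsAt π (2 * k - j) 0 j).card ≤ (2 * k - j - j).choose (k - j) := by
  classical
  rcases (linkedPairsAt π (2 * k - j) 0 j).eq_empty_or_nonempty with h0 | ⟨q, hq⟩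
  · simp [h0]
  have hhead : ∀ p ∈ linkedPairsAt π (2 * k - j) 0 j, ∀ p' ∈ linkedPairsAt π (2 * k - j) 0 j,
      ∀ c : Fin k, c.val < j → p.2 c = p'.2 c :=
    fun p hp p' hp' c hc => Fin.ext (by
      rw [val_head_eq hp (by omega) c hc, val_head_eq hp' (by omega) c hc])
  set C := (Finset.univ.filter fun b : Fin k => b.val < j).image q.2 with hC
  have hCcard : C.card = j := by
    rw [hC, Finset.card_image_of_injective _ (mem_linkedPairsAt.1 hq).2.1.injective,
      Fin.card_filter_val_lt, min_eq_right hj]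
  have : (2 * k - j - j).choose (k - j) = (Finset.powersetCard (k - j) Cᶜ).card := by
    rw [Finset.card_powersetCard, Finset.card_compl, hCcard, Fintype.card_fin]
  rw [this]
  refine Finset.card_le_card_of_injOn (fun p => tailImage p.2 j) ?_ ?_
  · intro p hp
    have hw := (mem_linkedPairsAt.1 hp).2.1.injective
    rw [Finset.mem_coe, Finset.mem_powersetCard]
    refine ⟨fun x hx => ?_, card_tailImage hw hj⟩
    obtain ⟨b, hb, rfl⟩ := mem_tailImage.1 hx
    simp only [hC, Finset.mem_compl, Finset.mem_image, Finset.mem_filter, Finset.mem_univ, true_and]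
    rintro ⟨c, hc, hcb⟩
    rw [← hhead p hp q hq c hc] at hcb
    have := hw hcb
    omega
  · intro p hp p' hp' hpp
    exact eq_of_tailImage_eq hp hp' (by omega) (hhead p hp p' hp') hpp

/-- The entries of `π` at the positions `i, …, i + j - 1` are increasing. -/
def IncreasingOn {k : ℕ} (π : Equiv.Perm (Fin k)) (i j : ℕ) : Prop :=
  ∀ a b : Fin k, i ≤ a.val → a < b → b.val < i + j → π a < π b

theorem lt_iff_of_mem_linkedPairsAt {k n i j : ℕ} {π : Equiv.Perm (Fin k)}
    {p : (Fin k → Fin n) × (Fin k → Fin n)} (hp : p ∈ linkedPairsAt π n i j) (hij : i + j ≤ k)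
    {a b : ℕ} (ha : a < j) (hb : b < j) : π ⟨i + a, by omega⟩ < π ⟨i + b, by omega⟩ ↔
      π ⟨a, by omega⟩ < π ⟨b, by omega⟩ := by
  obtain ⟨hv, hw, h⟩ := mem_linkedPairsAt.1 hp
  rw [← hv, ← hw, (h ⟨i + a, by omega⟩ ⟨a, by omega⟩).2 ⟨rfl, ha⟩,
    (h ⟨i + b, by omega⟩ ⟨b, by omega⟩).2 ⟨rfl, hb⟩]

theorem increasingOn_of_mem_linkedPairsAt {k n i j l : ℕ} {π : Equiv.Perm (Fin k)}
    {p : (Fin k → Fin n) × (Fin k → Fin n)} (hp : p ∈ linkedPairsAt π n i j) (hij : i + j ≤ k)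
    (hl : l ≤ j) (hinc : IncreasingOn π 0 l) : IncreasingOn π i l := by
  rintro ⟨a, ha⟩ ⟨b, hb⟩ hia hab hbi
  obtain ⟨a, rfl⟩ := Nat.exists_eq_add_of_le (show i ≤ a from hia)
  have hab : i + a < b := hab
  obtain ⟨b, rfl⟩ := Nat.exists_eq_add_of_le (show i ≤ b by omega)
  have hbi : i + b < i + l := hbi
  rw [lt_iff_of_mem_linkedPairsAt hp hij (by omega) (by omega)]
  exact hinc _ _ (Nat.zero_le _) (show a < b by omega) (show b < 0 + l by omega)

theorem Pattern.FixesFirst.le_apply {k : ℕ} {π : Equiv.Perm (Fin k)} {j : ℕ}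
    (h : Pattern.FixesFirst π j) (b : Fin k) (hb : j ≤ b.val) : j ≤ (π b).val := by
  by_contra hlt
  have := π.injective (h (π b) (not_le.1 hlt))
  rw [this] at hlt
  omega

/-- The run gains one entry: whatever follows the fixed prefix exceeds it. -/
theorem Pattern.FixesFirst.increasingOn {k : ℕ} {π : Equiv.Perm (Fin k)} {j : ℕ}
    (h : Pattern.FixesFirst π j) : IncreasingOn π 0 (j + 1) := by
  intro a b _ hab hb
  have hab' : a.val < b.val := hab
  rw [h a (by omega), Fin.lt_def]
  by_cases hbj : b.val < j
  · rwa [h b hbj]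
  · have := h.le_apply b (by omega)
    omega

theorem IncreasingOn.mono {k : ℕ} {π : Equiv.Perm (Fin k)} {i j i' j' : ℕ}
    (h : IncreasingOn π i j) (hi : i ≤ i') (hj : i' + j' ≤ i + j) : IncreasingOn π i' j' :=
  fun a b h1 h2 h3 => h a b (hi.trans h1) h2 (h3.trans_le hj)

theorem card_linkedPairsAt_eq_zero {k n i j l : ℕ} {π : Equiv.Perm (Fin k)} (hij : i + j ≤ k)
    (hl : l ≤ j) (hinc : IncreasingOn π 0 l) (hn : ¬ IncreasingOn π i l) :
    (linkedPairsAt π n i j).card = 0 := by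
  rw [Finset.card_eq_zero, Finset.eq_empty_iff_forall_notMem]
  exact fun p hp => hn (increasingOn_of_mem_linkedPairsAt hp hij hl hinc)

theorem Pattern.FixesFirst.val_head_eq {k i j : ℕ} {π : Equiv.Perm (Fin k)}
    (hπ : Pattern.FixesFirst π j)
    {p : (Fin k → Fin (2 * k - j)) × (Fin k → Fin (2 * k - j))}
    (hp : p ∈ linkedPairsAt π (2 * k - j) i j) (hij : i + j ≤ k) (c : Fin k) (hc : c.val < j) :
    (p.2 c).val = (π ⟨i + c, by omega⟩).val := by
  rw [_root_.val_head_eq hp hij c hc, Nat.add_eq_left, Finset.card_eq_zero,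
    Finset.filter_eq_empty_iff]
  rintro b - ⟨hb, hbc⟩
  have := hπ.le_apply b hb
  rw [hπ c hc, Fin.lt_def] at hbc
  omega

theorem card_filter_lt_orderEmbOfFin {n k : ℕ} {s : Finset (Fin n)} (hs : s.card = k) (r : Fin k) :
    (s.filter (· < s.orderEmbOfFin hs r)).card = r.val := by
  have h : HasPattern 1 (s.orderEmbOfFin hs) := fun a b => by simp
  have himg : Finset.univ.image (s.orderEmbOfFin hs) = s := by simp
  have := h.card_filter_lt r
  rwa [himg] at this

theorem orderEmbOfFin_eq_of_card {n k : ℕ} {s : Finset (Fin n)} (hs : s.card = k) {x : Fin n}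
    (hx : x ∈ s) {r : Fin k} (hr : (s.filter (· < x)).card = r.val) :
    s.orderEmbOfFin hs r = x := by
  have : x ∈ Set.range (s.orderEmbOfFin hs) := by
    rw [Finset.range_orderEmbOfFin]
    exact hx
  obtain ⟨r', rfl⟩ := this
  rw [card_filter_lt_orderEmbOfFin] at hr
  rw [Fin.ext hr]

/-- The first sequence arranges `Dᶜ` in pattern `π`, the second arranges `C ∪ D`, where `C` consists
of the values of `π` at positions `i, …, i + j - 1`. Since `D` lies above `last`, it disturbs no
rank up to `last`, so both place `C` on the overlap. -/
theorem exists_linkedPairAt {k i j : ℕ} {π : Equiv.Perm (Fin k)} (hπ : Pattern.FixesFirst π j)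
    (hj : 1 ≤ j) (hij : i + j ≤ k) (hinc : IncreasingOn π i j) {D : Finset (Fin (2 * k - j))}
    (hD : D.card = k - j)
    (hlast : ∀ x ∈ D, (π ⟨i + j - 1, by omega⟩).val < x.val) :
    ∃ p ∈ linkedPairsAt π (2 * k - j) i j, tailImage p.2 j = D := by
  classical
  have hkn : k ≤ 2 * k - j := by omega
  set last : ℕ := (π ⟨i + j - 1, by omega⟩).val with hlast_def
  have hle : ∀ a : Fin k, i ≤ a.val → a.val < i + j → (π a).val ≤ last := fun a h1 h2 => by
    rcases eq_or_lt_of_le (show a ≤ ⟨i + j - 1, by omega⟩ from Fin.le_def.2 (by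
      change a.val ≤ i + j - 1
      omega)) with h | h
    · rw [hlast_def, ← h]
    · exact (Fin.lt_def.1 (hinc a _ h1 h (show i + j - 1 < i + j by omega))).le
  let C : Finset (Fin (2 * k - j)) := (Finset.univ.filter fun a : Fin k => i ≤ a.val ∧ a.val < i + j).image
    fun a => (π a).castLE hkn
  have memC : ∀ x, x ∈ C ↔ ∃ a : Fin k, (i ≤ a.val ∧ a.val < i + j) ∧ (π a).castLE hkn = x := by
    simp [C]
  have hinj : Function.Injective fun a : Fin k => (π a).castLE hkn :=
    (Fin.castLE_injective hkn).comp π.injective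
  have hcount : ∀ c, c ≤ j →
      (Finset.univ.filter fun a : Fin k => i ≤ a.val ∧ a.val < i + c).card = c := fun c hc => by
    rw [← Finset.card_map Fin.valEmbedding]
    have : (Finset.univ.filter fun a : Fin k => i ≤ a.val ∧ a.val < i + c).map Fin.valEmbedding =
        Finset.Ico i (i + c) := by
      ext x
      simp only [Finset.mem_map, Finset.mem_filter, Finset.mem_univ, true_and, Finset.mem_Ico,
        Fin.valEmbedding_apply]
      exact ⟨by rintro ⟨a, h, rfl⟩; exact h, fun h => ⟨⟨x, by omega⟩, h, rfl⟩⟩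
    rw [this, Nat.card_Ico]
    omega
  have hCD : Disjoint C D := by
    rw [Finset.disjoint_left]
    intro x hx hxD
    obtain ⟨a, ⟨h1, h2⟩, rfl⟩ := (memC x).1 hx
    have h3 := hlast _ hxD
    have h4 := hle a h1 h2
    rw [Fin.val_castLE] at h3
    omega
  have hA : Dᶜ.card = k := by
    rw [Finset.card_compl, hD, Fintype.card_fin]
    omega
  have hB : (C ∪ D).card = k := by
    rw [Finset.card_union_of_disjoint hCD, hD, Finset.card_image_of_injective _ hinj,
      hcount j le_rfl]
    omega
  set f := Dᶜ.orderEmbOfFin hA with hf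
  set g := (C ∪ D).orderEmbOfFin hB with hg
  have f_eq : ∀ r : Fin k, r.val ≤ last → f r = r.castLE hkn := fun r hr => by
    refine orderEmbOfFin_eq_of_card hA ?_ ?_
    · rw [Finset.mem_compl]
      intro h
      have := hlast _ h
      rw [Fin.val_castLE] at this
      omega
    · have : Dᶜ.filter (· < r.castLE hkn) = Finset.Iio (r.castLE hkn) := by
        ext x
        simp only [Finset.mem_filter, Finset.mem_compl, Finset.mem_Iio, and_iff_right_iff_imp]
        intro hx hxD
        have := hlast _ hxD
        rw [Fin.lt_def, Fin.val_castLE] at hx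
        omega
      rw [this, Fin.card_Iio, Fin.val_castLE]
  have g_eq : ∀ c : Fin k, (hc : c.val < j) →
      g c = (π ⟨i + c, by omega⟩).castLE hkn := fun c hc => by
    refine orderEmbOfFin_eq_of_card hB (Finset.mem_union_left _ ((memC _).2
      ⟨⟨i + c, by omega⟩, ⟨by simp, by simpa using hc⟩, rfl⟩)) ?_
    have : (C ∪ D).filter (· < (π ⟨i + c, by omega⟩).castLE hkn) =
        (Finset.univ.filter fun a : Fin k => i ≤ a.val ∧ a.val < i + c).image
          fun a => (π a).castLE hkn := by
      ext x
      rw [Finset.mem_filter, Finset.mem_union, memC]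
      simp only [Finset.mem_image, Finset.mem_filter, Finset.mem_univ, true_and]
      constructor
      · rintro ⟨⟨a, ⟨h1, h2⟩, rfl⟩ | h1, hx⟩
        · refine ⟨a, ⟨h1, ?_⟩, rfl⟩
          by_contra hac
          rcases eq_or_lt_of_le (show (⟨i + c, by omega⟩ : Fin k) ≤ a from not_lt.1 hac) with h | h
          · rw [h] at hx
            exact lt_irrefl _ hx
          · exact lt_asymm hx (hinc _ a (by simp) h h2)
        · have h3 := hlast _ h1
          have h4 := hle ⟨i + c, by omega⟩ (by simp) (by simpa using hc)
          rw [Fin.lt_def, Fin.val_castLE] at hx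
          omega
      · rintro ⟨a, ⟨h1, h2⟩, rfl⟩
        exact ⟨Or.inl ⟨a, ⟨h1, by omega⟩, rfl⟩,
          hinc a ⟨i + c, by omega⟩ h1 h2 (by simpa using hc)⟩
    rw [this, Finset.card_image_of_injective _ hinj, hcount _ hc.le]
  have w_eq : ∀ c : Fin k, (hc : c.val < j) → g (π c) = (π ⟨i + c, by omega⟩).castLE hkn :=
    fun c hc => by
      have := g_eq (π c) (by rw [hπ c hc]; exact hc)
      rw [this]
      congr 3
      rw [hπ c hc]
  have v_eq : ∀ a : Fin k, i ≤ a.val → a.val < i + j → f (π a) = (π a).castLE hkn :=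
    fun a h1 h2 => f_eq _ (hle a h1 h2)
  have linked : LinkedAt (fun a => f (π a)) (fun a => g (π a)) i j := by
    intro a b
    constructor
    · intro h
      have h1 : f (π a) ∈ Dᶜ := Finset.orderEmbOfFin_mem _ _ _
      have h2 : g (π b) ∈ C ∪ D := Finset.orderEmbOfFin_mem _ _ _
      simp only at h
      rw [← h, Finset.mem_union] at h2
      obtain ⟨a', ⟨h3, h4⟩, h5⟩ := (memC _).1 (h2.resolve_right (Finset.mem_compl.1 h1))
      rw [← v_eq a' h3 h4] at h5
      obtain rfl := π.injective (f.injective h5)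
      rw [v_eq a' h3 h4] at h
      have h6 := w_eq ⟨a'.val - i, by omega⟩ (by simp only; omega)
      have h7 : (⟨i + (a'.val - i), by omega⟩ : Fin k) = a' := Fin.ext (by simp only; omega)
      simp only [h7] at h6
      rw [h] at h6
      have := π.injective (g.injective h6)
      rw [← this]
      simp only
      omega
    · rintro ⟨h1, h2⟩
      have hib : i + b.val < k := by omega
      obtain rfl : a = ⟨i + b, hib⟩ := Fin.ext h1
      exact (v_eq _ (by simp) (by simpa using h2)).trans (w_eq b h2).symm
  refine ⟨(fun a => f (π a), fun a => g (π a)), mem_linkedPairsAt.2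
    ⟨fun a b => by simp, fun a b => by simp, linked⟩, ?_⟩
  rw [← compl_inj_iff, ← linked.image_eq_compl (f.injective.comp π.injective)
    (g.injective.comp π.injective) hij]
  have : (Finset.univ.image fun a => f (π a)) = (Finset.univ.image π).image f := by
    rw [Finset.image_image]
    rfl
  rw [this, Finset.image_univ_equiv]
  simp [hf]

/-- The tail set parametrizes the pairs. It lies above the shared label `last`, because `π` exceeds
its fixed prefix afterwards, and is otherwise arbitrary. -/
theorem card_linkedPairsAt {k i j : ℕ} {π : Equiv.Perm (Fin k)} (hπ : Pattern.FixesFirst π j)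
    (hj : 1 ≤ j) (hij : i + j ≤ k) (hinc : IncreasingOn π i j) :
    (linkedPairsAt π (2 * k - j) i j).card =
      (2 * k - j - 1 - (π ⟨i + j - 1, by omega⟩).val).choose (k - j) := by
  set last : Fin (2 * k - j) := (π ⟨i + j - 1, by omega⟩).castLE (by omega) with hlast
  have : (2 * k - j - 1 - (π ⟨i + j - 1, by omega⟩).val).choose (k - j) =
      (Finset.powersetCard (k - j) (Finset.Ioi last)).card := by
    rw [Finset.card_powersetCard, Fin.card_Ioi, hlast, Fin.val_castLE]
  rw [this]
  refine Finset.card_bij (fun p _ => tailImage p.2 j) ?_ ?_ ?_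
  · intro p hp
    have hw := (mem_linkedPairsAt.1 hp).2.1
    rw [Finset.mem_powersetCard]
    refine ⟨fun x hx => ?_, card_tailImage hw.injective (by omega)⟩
    obtain ⟨b, hb, rfl⟩ := mem_tailImage.1 hx
    have h1 : p.2 ⟨j - 1, by omega⟩ = last := Fin.ext (by
      rw [hπ.val_head_eq hp hij _ (by simp only; omega), hlast, Fin.val_castLE]
      congr 3
      simp only
      omega)
    rw [Finset.mem_Ioi, ← h1, hw, hπ ⟨j - 1, by omega⟩ (by simp only; omega), Fin.lt_def]
    have := hπ.le_apply b hb
    simp only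
    omega
  · intro p hp q hq hpq
    exact eq_of_tailImage_eq hp hq hij (fun c hc => Fin.ext (by
      rw [hπ.val_head_eq hp hij c hc, hπ.val_head_eq hq hij c hc])) hpq
  · intro D hD
    obtain ⟨h1, h2⟩ := Finset.mem_powersetCard.1 hD
    obtain ⟨p, hp, h3⟩ := exists_linkedPairAt hπ hj hij hinc h2 fun x hx => by
      simpa [Fin.lt_def, hlast] using Finset.mem_Ioi.1 (h1 hx)
    exact ⟨p, hp, h3⟩

/-! ### Superincreasing sequences and binomial coefficients. -/

theorem Finset.eq_of_sum_eq_of_superincreasing {f : ℕ → ℕ} :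
    ∀ {n : ℕ}, (∀ b < n, ∑ c ∈ Finset.range b, f c < f b) → ∀ {S T : Finset ℕ},
      S ⊆ Finset.range n → T ⊆ Finset.range n → ∑ b ∈ S, f b = ∑ b ∈ T, f b → S = T
  | 0, _, S, T, hS, hT, _ => by
    rw [Finset.range_zero, Finset.subset_empty] at hS hT
    rw [hS, hT]
  | n + 1, hf, S, T, hS, hT, h => by
    have hsub : ∀ {S : Finset ℕ}, S ⊆ Finset.range (n + 1) → S.erase n ⊆ Finset.range n :=
      fun hS x hx => by
        have h1 := Finset.mem_range.1 (hS (Finset.mem_of_mem_erase hx))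
        have h2 := Finset.ne_of_mem_erase hx
        exact Finset.mem_range.2 (by omega)
    have hne : ∀ {S T : Finset ℕ}, S ⊆ Finset.range (n + 1) → n ∉ S → n ∈ T →
        ∑ b ∈ S, f b < ∑ b ∈ T, f b := fun {S T} hS h1 h2 => by
      calc ∑ b ∈ S, f b ≤ ∑ b ∈ Finset.range n, f b :=
            Finset.sum_le_sum_of_subset (Finset.erase_eq_of_notMem h1 ▸ hsub hS)
        _ < f n := hf n n.lt_succ_self
        _ ≤ ∑ b ∈ T, f b := Finset.single_le_sum (fun _ _ => Nat.zero_le _) h2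
    have herase : ∑ b ∈ S.erase n, f b = ∑ b ∈ T.erase n, f b → S.erase n = T.erase n :=
      Finset.eq_of_sum_eq_of_superincreasing (fun b hb => hf b (hb.trans n.lt_succ_self))
        (hsub hS) (hsub hT)
    by_cases h1 : n ∈ S <;> by_cases h2 : n ∈ T
    · have := herase (by
        rw [← Finset.add_sum_erase S f h1, ← Finset.add_sum_erase T f h2] at h
        exact Nat.add_left_cancel h)
      rw [← Finset.insert_erase h1, ← Finset.insert_erase h2, this]
    · exact absurd h (hne hT h2 h1).ne'
    · exact absurd h (hne hS h1 h2).ne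
    · rw [← Finset.erase_eq_of_notMem h1, ← Finset.erase_eq_of_notMem h2]
      exact herase (by rwa [Finset.erase_eq_of_notMem h1, Finset.erase_eq_of_notMem h2])

theorem sum_range_choose_lt (a b : ℕ) (hb : b ≤ a) :
    ∑ c ∈ Finset.range b, (a + c).choose a < (a + b).choose a := by
  have hsum : ∀ b, ∑ c ∈ Finset.range b, (a + c).choose a = (a + b).choose (a + 1) := fun b => by
    induction b with
    | zero => simp
    | succ b ih => rw [Finset.sum_range_succ, ih, ← add_assoc, Nat.choose_succ_succ, add_comm]
  rw [hsum]
  -- After multiplication by `a + 1`, the hockey-stick sum becomes `(a + b).choose a * b`, and `b <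
  -- a + 1`.
  refine Nat.lt_of_mul_lt_mul_right (a := a + 1) ?_
  rw [Nat.choose_succ_right_eq, Nat.add_sub_cancel_left]
  exact Nat.mul_lt_mul_of_pos_left (by omega) (Nat.choose_pos (by omega))

/-! ### Recovering streaks and heights. -/

namespace Pattern

theorem FixesFirst.mono {k m m' : ℕ} {π : Equiv.Perm (Fin k)} (h : FixesFirst π m) (hm : m' ≤ m) :
    FixesFirst π m' := fun i hi => h i (hi.trans_le hm)

theorem fixesFirst_streak {k : ℕ} (π : Equiv.Perm (Fin k)) : FixesFirst π (streak π) :=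
  Nat.findGreatest_spec (P := FixesFirst π) (Nat.zero_le k) fun _ hi => absurd hi (Nat.not_lt_zero _)

theorem IsGrounded.streak_lt {k : ℕ} {π : Equiv.Perm (Fin k)} (h : IsGrounded π) :
    streak π < k := by
  by_contra hk
  refine h.1 (Equiv.ext fun i => ?_)
  exact fixesFirst_streak π i (by omega)

theorem IsGrounded.one_le_streak_and_not_increasingOn {k : ℕ} {π : Equiv.Perm (Fin k)}
    (h : IsGrounded π) : 1 ≤ streak π ∧
      ∀ a, 1 ≤ a → a + streak π < k → ¬ IncreasingOn π a (streak π + 1) := by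
  have hlt := h.streak_lt
  obtain ⟨-, m, hm1, hmk, hfix, hno⟩ := h
  have hle : m ≤ streak π := Nat.le_findGreatest hmk hfix
  have heq : m = streak π := by
    by_contra hne
    -- A streak longer than `m` would itself contain a forbidden run of `m + 1` entries, once the
    -- entry following it is included.
    refine hno ⟨1, le_rfl, by omega, fun i j h1 h2 h3 => ?_⟩
    exact (fixesFirst_streak π).increasingOn i j (Nat.zero_le _) h2 (by omega)
  rw [← heq]
  refine ⟨hm1, fun a ha hak hinc => hno ⟨a, ha, hak, fun i j h1 h2 h3 => ?_⟩⟩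
  exact hinc i j h1 h2 (by omega)

theorem IsGrounded.card_linkedPairsAt_eq_zero {k n i j : ℕ} {π : Equiv.Perm (Fin k)}
    (h : IsGrounded π) (hj : streak π < j) (hij : i + 1 + j ≤ k) :
    (linkedPairsAt π n (i + 1) j).card = 0 :=
  _root_.card_linkedPairsAt_eq_zero hij hj (fixesFirst_streak π).increasingOn
    (h.one_le_streak_and_not_increasingOn.2 _ (by omega) (by omega))

theorem card_linkedPairsAt_zero {k j : ℕ} {π : Equiv.Perm (Fin k)} (hπ : FixesFirst π j)
    (hj : 1 ≤ j) (hjk : j ≤ k) :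
    (linkedPairsAt π (2 * k - j) 0 j).card = (2 * k - j - j).choose (k - j) := by
  rw [card_linkedPairsAt hπ hj (by omega) (hπ.increasingOn.mono le_rfl (by omega))]
  have : (π ⟨0 + j - 1, by omega⟩).val = j - 1 := by
    rw [hπ _ (by simp only; omega)]
    simp
  rw [this]
  congr 1
  omega

/-- Take `j = streak π'` and suppose it exceeds `streak π`. Groundedness of `π` kills all positive
shifts, and its shift 0 contributes at most what `π'` attains there; but `π'` also has pairs at
shift 1. -/
theorem streak_le_streak {k : ℕ} {π π' : Equiv.Perm (Fin k)} (hπ : IsGrounded π)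
    (hπ' : IsGrounded π') (h : StronglyCForestWilfEquivalent π π') : streak π' ≤ streak π := by
  by_contra hlt
  rw [not_le] at hlt
  have hk := hπ'.streak_lt
  set j := streak π' with hj
  have hfix : FixesFirst π' j := fixesFirst_streak π'
  have e := h.card_linkedPairs_eq (2 * k - j) (by omega)
  rw [card_linkedPairs_eq_sum π (by omega) (by omega),
    card_linkedPairs_eq_sum π' (by omega) (by omega),
    Finset.sum_eq_zero (fun i hi => hπ.card_linkedPairsAt_eq_zero hlt (by
      have := Finset.mem_range.1 hi
      omega)), card_linkedPairsAt_zero hfix (by omega) hk.le] at e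
  have h1 := card_linkedPairsAt_zero_le π hk.le
  have h2 : 0 < (linkedPairsAt π' (2 * k - j) (0 + 1) j).card := by
    rw [card_linkedPairsAt hfix (by omega) (by omega)
      (hfix.increasingOn.mono (Nat.zero_le _) (by omega))]
    refine Nat.choose_pos ?_
    omega
  have h3 := Finset.single_le_sum (s := Finset.range (k - j))
    (f := fun i => (linkedPairsAt π' (2 * k - j) (i + 1) j).card) (fun _ _ => Nat.zero_le _)
    (Finset.mem_range.2 (show 0 < k - j by omega))
  omega

theorem le_height_iff {k j : ℕ} {π : Equiv.Perm (Fin k)} {t : Fin k} :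
    j ≤ height π t ↔ ∃ i, i + j = (π.symm t).val ∧ IncreasingOn π (i + 1) j := by
  set p := π.symm t with hp
  have hinc : ∀ i, i + j = p.val → (IncreasingEndingAt π p j ↔ IncreasingOn π (i + 1) j) :=
    fun i hi => forall₂_congr fun a b => by
      rw [Fin.le_def]
      constructor
      · intro H h1 h2 h3
        exact H (by omega) h2 (by omega)
      · intro H h1 h2 h3
        exact H (by omega) h2 (by omega)
  constructor
  · intro h
    have h1 : j ≤ p.val := h.trans (Nat.findGreatest_le _)
    obtain ⟨i, hi⟩ : ∃ i, i + j = p.val := ⟨p.val - j, by omega⟩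
    refine ⟨i, hi, (hinc i hi).1 fun a b ha hab hb => ?_⟩
    have := Nat.findGreatest_spec (P := IncreasingEndingAt π p) (Nat.zero_le p.val)
      fun a b h1 h2 h3 => by
        rw [Fin.lt_def] at h2
        rw [Fin.le_def] at h3
        omega
    exact this a b (ha.trans_le (Nat.add_le_add_left h _)) hab hb
  · rintro ⟨i, hi, h⟩
    exact Nat.le_findGreatest (by omega) ((hinc i hi).2 h)

theorem IsGrounded.height_le_streak {k : ℕ} {π : Equiv.Perm (Fin k)} (h : IsGrounded π)
    (t : Fin k) : height π t ≤ streak π := by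
  by_contra hlt
  obtain ⟨i, hi, hinc⟩ := le_height_iff.1 (not_le.1 hlt)
  exact h.one_le_streak_and_not_increasingOn.2 (i + 1) (by omega) (by omega) hinc

/-- Shift `i + 1` corresponds to the value `t` of `π` at position `i + j`, the end of the overlap;
the shift is possible exactly when a run of `j` entries after the first position ends there. -/
theorem sum_card_linkedPairsAt {k j : ℕ} {π : Equiv.Perm (Fin k)} (hπ : FixesFirst π j)
    (hj : 1 ≤ j) (hjk : j ≤ k) :
    ∑ i ∈ Finset.range (k - j), (linkedPairsAt π (2 * k - j) (i + 1) j).card =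
      ∑ t ∈ Finset.univ.filter (fun t => j ≤ height π t),
        (2 * k - j - 1 - t.val).choose (k - j) := by
  classical
  rw [← Finset.sum_filter_of_ne (p := fun i => IncreasingOn π (i + 1) j)]
  · refine Finset.sum_bij (fun i hi => π ⟨i + j, by
      have := Finset.mem_range.1 (Finset.mem_filter.1 hi).1
      omega⟩) ?_ ?_ ?_ ?_
    · intro i hi
      rw [Finset.mem_filter, le_height_iff]
      exact ⟨Finset.mem_univ _, i, by simp, (Finset.mem_filter.1 hi).2⟩
    · intro i _ i' _ hii
      have := congrArg Fin.val (π.injective hii)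
      simp only at this
      omega
    · intro t ht
      obtain ⟨i, hi, hinc⟩ := le_height_iff.1 (Finset.mem_filter.1 ht).2
      refine ⟨i, Finset.mem_filter.2 ⟨Finset.mem_range.2 (by omega), hinc⟩, ?_⟩
      have : (⟨i + j, by omega⟩ : Fin k) = π.symm t := Fin.ext hi
      rw [this, Equiv.apply_symm_apply]
    · intro i hi
      obtain ⟨h1, h2⟩ := Finset.mem_filter.1 hi
      have := Finset.mem_range.1 h1
      rw [card_linkedPairsAt hπ hj (by omega) h2]
      congr 5
      omega
  · intro i hi hne
    have := Finset.mem_range.1 hi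
    by_contra hinc
    exact hne (_root_.card_linkedPairsAt_eq_zero (by omega) le_rfl
      (hπ.increasingOn.mono le_rfl (by omega)) hinc)

theorem FixesFirst.le_of_le_height {k j : ℕ} {π : Equiv.Perm (Fin k)} (hπ : FixesFirst π j)
    {t : Fin k} (ht : j ≤ height π t) : j ≤ t.val := by
  obtain ⟨i, hi, -⟩ := le_height_iff.1 ht
  simpa using hπ.le_apply (π.symm t) (by omega)

theorem le_height_iff_of_equivalent {k j : ℕ} {π π' : Equiv.Perm (Fin k)}
    (h : StronglyCForestWilfEquivalent π π') (hπ : FixesFirst π j) (hπ' : FixesFirst π' j)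
    (hj : 1 ≤ j) (hjk : j ≤ k) (t : Fin k) : j ≤ height π t ↔ j ≤ height π' t := by
  have e := h.card_linkedPairs_eq (2 * k - j) (by omega)
  rw [card_linkedPairs_eq_sum π hj hjk, card_linkedPairs_eq_sum π' hj hjk,
    card_linkedPairsAt_zero hπ hj hjk, card_linkedPairsAt_zero hπ' hj hjk,
    sum_card_linkedPairsAt hπ hj hjk, sum_card_linkedPairsAt hπ' hj hjk] at e
  have e := Nat.eq_of_mul_eq_mul_left two_pos (Nat.add_left_cancel e)
  -- With `b = k - 1 - t` the binomials become `(k - j + b).choose (k - j)`. Height at least `j`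
  -- forces `j ≤ t`, so `b < k - j`, the range where they are superincreasing.
  have hinj : Function.Injective fun t : Fin k => k - 1 - t.val := fun s t hst => by
    simp only at hst
    omega
  have hsum : ∀ S : Finset (Fin k), ∑ t ∈ S, (2 * k - j - 1 - t.val).choose (k - j) =
      ∑ b ∈ S.image fun t => k - 1 - t.val, (k - j + b).choose (k - j) := fun S => by
    rw [Finset.sum_image fun s _ t _ hst => hinj hst]
    refine Finset.sum_congr rfl fun t _ => ?_
    congr 1
    omega
  have hsub : ∀ π : Equiv.Perm (Fin k), FixesFirst π j →
      (Finset.univ.filter fun t => j ≤ height π t).image (fun t => k - 1 - t.val) ⊆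
        Finset.range (k - j) := fun π hπ x hx => by
    obtain ⟨t, ht, rfl⟩ := Finset.mem_image.1 hx
    have := hπ.le_of_le_height (Finset.mem_filter.1 ht).2
    exact Finset.mem_range.2 (by omega)
  rw [hsum, hsum] at e
  have := Finset.image_injective hinj (Finset.eq_of_sum_eq_of_superincreasing
    (fun b hb => sum_range_choose_lt (k - j) b hb.le) (hsub π hπ) (hsub π' hπ') e)
  simpa using Finset.ext_iff.1 this t

end Pattern

theorem proposition3 {k : ℕ} (π π' : Equiv.Perm (Fin k))
    (hπ : Pattern.IsGrounded π) (hπ' : Pattern.IsGrounded π')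
    (h : StronglyCForestWilfEquivalent π π') :
    Pattern.streak π = Pattern.streak π' ∧
      ∀ i : Fin k, 2 ≤ i.val + 1 → Pattern.height π i = Pattern.height π' i := by
  have hs : Pattern.streak π = Pattern.streak π' :=
    le_antisymm (Pattern.streak_le_streak hπ' hπ fun m n => (h m n).symm)
      (Pattern.streak_le_streak hπ hπ' h)
  refine ⟨hs, fun t _ => eq_of_forall_le_iff fun j => ?_⟩
  rcases Nat.eq_zero_or_pos j with rfl | hj
  · simp
  by_cases hjs : j ≤ Pattern.streak π
  · exact Pattern.le_height_iff_of_equivalent h ((Pattern.fixesFirst_streak π).mono hjs)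
      ((Pattern.fixesFirst_streak π').mono (hs ▸ hjs)) hj (hjs.trans hπ.streak_lt.le) t
  · have h1 := hπ.height_le_streak t
    have h2 := hπ'.height_le_streak t
    omega
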